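/- Let $k$ be an algebraically closed field, and let $\mathsf{Hopf}^{\mathsf{bicom}}_k$ be the category of commutative and cocommutative Hopf algebras over $k$, which is abelian with zero morphism $A\to k\to B$ (the counit followed by the unit). For an abelian category $\mathcal A$, an $\mathcal A$-valued homology theory $E_\bullet=\{E_q,\partial_q\}_{q\in\mathbb Z}$ consists of functors $E_q$ from the category of pairs $(K,K')$ of finite CW-spaces and continuous maps of pairs to $\mathcal A$, and natural transformations $\partial_q\colon E_{q+1}(K,K')\to E_q(K')=E_q(K',\emptyset)$, such that homotopic maps of pairs induce the same morphism, the inclusion induces an isomorphism $E_q(K,K\cap L)\cong E_q(K\cup L,L)$ for subcomplexes $K,L$ of a finite CW complex $X$, and the long sequence $$\cdots\to E_q(K')\to E_q(K)\to E_q(K,K')\xrightarrow{\partial_{q-1}}E_{q-1}(K')\to\cdots$$ is exact in $\mathcal A$. An isomorphism of homology theories is a family of natural isomorphisms $E_q\cong E'_q$ compatible with the maps $\partial_q$. The group Hopf algebra functor $G\mapsto kG$ from the category $\mathsf{Ab}$ of abelian groups to $\mathsf{Hopf}^{\mathsf{bicom}}_k$ is exact, so an $\mathsf{Ab}$-valued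 homology theory $F_\bullet$ induces a $\mathsf{Hopf}^{\mathsf{bicom}}_k$-valued homology theory $kF_\bullet$. Let $E_\bullet$ be a $\mathsf{Hopf}^{\mathsf{bicom}}_k$-valued homology theory such that, for every $q\in\mathbb Z$ and every pair $(K,K')$ of finite CW-spaces, the Hopf algebra $E_q(K,K')$ is finite-dimensional and cosemisimple, i.e. its dual Hopf algebra is semisimple. Then $E_\bullet$ is induced by the group Hopf algebra functor: the groups of group-like elements $$F_q(K,K')=\{\,0\neq v\in E_q(K,K') : \Delta(v)=v\otimes v\,\},$$ with the induced homomorphisms and the restrictions of the maps $\partial_q$, form an $\mathsf{Ab}$-valued homology theory $F_\bullet$, and $E_\bullet\cong kF_\bullet$ as homology theories. -/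

import Mathlib

open CategoryTheory

universe w v₁ v₂ u₁ u₂ u

namespace CWPairs

open Topology Set

/-- `(X, A)` is a pair of finite CW-spaces: `X` is Hausdorff and admits a CW structure with finitely
many cells for which `A` is a subcomplex. -/
def IsFiniteCWPair (X : Type w) [TopologicalSpace X] (A : Set X) : Prop :=
  T2Space X ∧ ∃ (_ : CWComplex (univ : Set X)) (_ : CWComplex.Finite (univ : Set X))
    (E : CWComplex.Subcomplex (univ : Set X)), (E : Set X) = A

section Restrict

variable {X : Type w} [TopologicalSpace X]

open Classical in
/-- A characteristic map of a cell of `C ⊆ X`, as a map into the subspace `C`. -/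
noncomputable def restrictMap {C : Set X} [CWComplex C] (n : ℕ) (i : RelCWComplex.cell C n) :
    PartialEquiv (Fin n → ℝ) C where
  toFun x := if h : RelCWComplex.map n i x ∈ C then ⟨_, h⟩ else
    ⟨RelCWComplex.map n i 0, RelCWComplex.closedCell_subset_complex n i
      ⟨0, by simp, rfl⟩⟩
  invFun y := (RelCWComplex.map n i).symm y
  source := Metric.ball 0 1
  target := Subtype.val ⁻¹' (RelCWComplex.map n i).target
  map_source' x hx := by
    have h : RelCWComplex.map n i x ∈ C :=
      RelCWComplex.closedCell_subset_complex n i ⟨x, Metric.ball_subset_closedBall hx, rfl⟩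
    rw [dif_pos h]
    exact (RelCWComplex.map n i).map_source (by rwa [RelCWComplex.source_eq])
  map_target' y hy := by
    have := (RelCWComplex.map n i).map_target hy
    rwa [RelCWComplex.source_eq] at this
  left_inv' x hx := by
    have h : RelCWComplex.map n i x ∈ C :=
      RelCWComplex.closedCell_subset_complex n i ⟨x, Metric.ball_subset_closedBall hx, rfl⟩
    rw [dif_pos h]
    exact (RelCWComplex.map n i).left_inv (by rwa [RelCWComplex.source_eq])
  right_inv' y hy := by
    have h : RelCWComplex.map n i ((RelCWComplex.map n i).symm y) = y :=
      (RelCWComplex.map n i).right_inv hy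
    apply Subtype.ext
    rw [dif_pos (by rw [h]; exact y.2)]
    exact h

theorem val_restrictMap {C : Set X} [CWComplex C] (n : ℕ) (i : RelCWComplex.cell C n)
    {x : Fin n → ℝ} (hx : x ∈ Metric.closedBall 0 1) :
    (restrictMap n i x : X) = RelCWComplex.map n i x := by
  have h : RelCWComplex.map n i x ∈ C :=
    RelCWComplex.closedCell_subset_complex n i ⟨x, hx, rfl⟩
  simp [restrictMap, dif_pos h]

theorem restrictMap_image {C : Set X} [CWComplex C] (n : ℕ) (i : RelCWComplex.cell C n)
    {s : Set (Fin n → ℝ)} (hs : s ⊆ Metric.closedBall 0 1) :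
    restrictMap n i '' s = Subtype.val ⁻¹' (RelCWComplex.map n i '' s) := by
  ext y
  constructor
  · rintro ⟨x, hx, rfl⟩
    exact ⟨x, hx, (val_restrictMap n i (hs hx)).symm⟩
  · rintro ⟨x, hx, h⟩
    exact ⟨x, hx, Subtype.ext ((val_restrictMap n i (hs hx)).trans h)⟩

/-- A finite CW complex `C ⊆ X` with a subcomplex `A` gives a pair of finite CW-spaces. -/
theorem isFiniteCWPair_coe [T2Space X] (C : Set X) [CWComplex C] [CWComplex.Finite C]
    (A : CWComplex.Subcomplex C) :
    IsFiniteCWPair C (Subtype.val ⁻¹' (A : Set X)) := by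
  have h1 : ∀ᶠ n in Filter.atTop, IsEmpty (RelCWComplex.cell C n) :=
    RelCWComplex.FiniteDimensional.eventually_isEmpty_cell
  have h2 : ∀ n, _root_.Finite (RelCWComplex.cell C n) := RelCWComplex.FiniteType.finite_cell
  have h3 : ∀ (n : ℕ) (i : RelCWComplex.cell C n),
      (restrictMap n i).source = Metric.ball 0 1 := fun _ _ => rfl
  have h4 : ∀ (n : ℕ) (i : RelCWComplex.cell C n),
      ContinuousOn (restrictMap n i) (Metric.closedBall 0 1) := fun n i => by
    rw [Topology.IsInducing.subtypeVal.continuousOn_iff]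
    exact (RelCWComplex.continuousOn n i).congr fun x hx => val_restrictMap n i hx
  have h5 : ∀ (n : ℕ) (i : RelCWComplex.cell C n),
      ContinuousOn (restrictMap n i).symm (restrictMap n i).target := fun n i =>
    (RelCWComplex.continuousOn_symm n i).comp continuous_subtype_val.continuousOn fun _ h => h
  have h6 : (univ : Set (Σ n, RelCWComplex.cell C n)).PairwiseDisjoint
      (fun ni ↦ restrictMap ni.1 ni.2 '' Metric.ball 0 1) := fun a ha b hb hab => by
    simp only [Function.onFun, restrictMap_image _ _ Metric.ball_subset_closedBall]
    exact (RelCWComplex.pairwiseDisjoint' (C := C) ha hb hab).preimage _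
  have h7 : ∀ (n : ℕ) (i : RelCWComplex.cell C n), MapsTo (restrictMap n i) (Metric.sphere 0 1)
      (⋃ (m < n) (j : RelCWComplex.cell C m), restrictMap m j '' Metric.closedBall 0 1) :=
    fun n i x hx => by
      obtain ⟨I, hI⟩ := CWComplex.mapsTo n i
      have := hI hx
      simp only [mem_iUnion] at this ⊢
      obtain ⟨m, hm, j, -, hj⟩ := this
      refine ⟨m, hm, j, ?_⟩
      rw [restrictMap_image _ _ subset_rfl, mem_preimage,
        val_restrictMap n i (Metric.sphere_subset_closedBall hx)]
      exact hj
  have h8 : ⋃ (n : ℕ) (j : RelCWComplex.cell C n), restrictMap n j '' Metric.closedBall 0 1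
      = (univ : Set C) := by
    simp only [restrictMap_image _ _ subset_rfl, ← preimage_iUnion]
    refine eq_univ_of_forall fun y => ?_
    rw [mem_preimage]
    have := CWComplex.union (C := C)
    exact this.symm ▸ y.2
  refine ⟨inferInstance, CWComplex.mkFinite univ _ _ h1 h2 h3 h4 h5 h6 h7 h8,
    CWComplex.finite_mkFinite univ _ _ h1 h2 h3 h4 h5 h6 h7 h8, ?_⟩
  let := CWComplex.mkFinite univ _ _ h1 h2 h3 h4 h5 h6 h7 h8
  refine ⟨⟨Subtype.val ⁻¹' (A : Set X), fun n => A.I n,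
    A.closed.preimage continuous_subtype_val, ?_⟩, rfl⟩
  rw [empty_union, ← CWComplex.Subcomplex.union (E := A), preimage_iUnion]
  refine iUnion_congr fun n => ?_
  rw [preimage_iUnion]
  refine iUnion_congr fun j => ?_
  exact restrictMap_image (C := C) n j.1 Metric.ball_subset_closedBall

section Subcomplexes

variable {C : Set X} [CWComplex C]

/-- The empty subcomplex. -/
def emptySubcomplex (C : Set X) [CWComplex C] : CWComplex.Subcomplex C where
  carrier := ∅
  I _ := ∅
  closed' := isClosed_empty
  union' := by simp

/-- The intersection of two subcomplexes. -/
def interSubcomplex (K L : CWComplex.Subcomplex C) : CWComplex.Subcomplex C where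
  carrier := (K : Set X) ∩ L
  I n := K.I n ∩ L.I n
  closed' := K.closed.inter L.closed
  union' := by
    rw [empty_union]
    ext x
    simp only [mem_iUnion, ← CWComplex.Subcomplex.union (E := K),
      ← CWComplex.Subcomplex.union (E := L), mem_inter_iff, Subtype.exists]
    constructor
    · rintro ⟨n, i, hi, hx⟩
      exact ⟨⟨n, i, hi.1, hx⟩, ⟨n, i, hi.2, hx⟩⟩
    · rintro ⟨⟨n, i, hi, hx⟩, ⟨m, j, hj, hy⟩⟩
      have : (⟨n, i⟩ : Σ n, RelCWComplex.cell C n) = ⟨m, j⟩ := by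
        by_contra hne
        exact (disjoint_left.1 (RelCWComplex.disjoint_openCell_of_ne hne)) hx hy
      cases this
      exact ⟨n, i, ⟨hi, hj⟩, hx⟩

/-- The union of two subcomplexes. -/
def unionSubcomplex (K L : CWComplex.Subcomplex C) : CWComplex.Subcomplex C where
  carrier := (K : Set X) ∪ L
  I n := K.I n ∪ L.I n
  closed' := K.closed.union L.closed
  union' := by
    rw [empty_union]
    ext x
    simp only [mem_iUnion, ← CWComplex.Subcomplex.union (E := K),
      ← CWComplex.Subcomplex.union (E := L), mem_union, Subtype.exists]
    constructor
    · rintro ⟨n, i, hi | hi, hx⟩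
      exacts [Or.inl ⟨n, i, hi, hx⟩, Or.inr ⟨n, i, hi, hx⟩]
    · rintro (⟨n, i, hi, hx⟩ | ⟨n, i, hi, hx⟩)
      exacts [⟨n, i, Or.inl hi, hx⟩, ⟨n, i, Or.inr hi, hx⟩]

/-- Subcomplexes `A ⊆ B` of a finite CW complex give a pair of finite CW-spaces `(B, A)`. -/
theorem isFiniteCWPair_subcomplex [T2Space X] [CWComplex.Finite C]
    (A B : CWComplex.Subcomplex C) (h : (A : Set X) ⊆ B) :
    IsFiniteCWPair (B : Set X) (Subtype.val ⁻¹' (A : Set X)) := by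
  have hI : ∀ n (i : RelCWComplex.cell C n), i ∈ A.I n → i ∈ B.I n := fun n i hi => by
    by_contra hB
    have h1 := RelCWComplex.Subcomplex.disjoint_openCell_subcomplex_of_not_mem B hB
    have h2 := (RelCWComplex.Subcomplex.openCell_subset_of_mem A hi).trans h
    have h3 : RelCWComplex.map n i 0 ∈ RelCWComplex.openCell n i := ⟨0, by simp, rfl⟩
    exact disjoint_left.1 h1 h3 (h2 h3)
  let A' : CWComplex.Subcomplex (B : Set X) :=
    { carrier := A
      I := fun n => {i : B.I n | i.1 ∈ A.I n}
      closed' := A.closed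
      union' := by
        rw [empty_union, ← CWComplex.Subcomplex.union (E := A)]
        refine iUnion_congr fun n => ?_
        ext x
        simp only [mem_iUnion, Subtype.exists]
        constructor
        · rintro ⟨i, hi, hx⟩
          exact ⟨i.1, hi, hx⟩
        · rintro ⟨i, hi, hx⟩
          exact ⟨⟨i, hI n i hi⟩, hi, hx⟩ }
  exact isFiniteCWPair_coe (B : Set X) A'

end Subcomplexes

end Restrict

end CWPairs

section Theory

open Topology Set

/-- A pair `(K, K')` of finite CW-spaces. -/
structure FinCWPair where
  /-- The space `K`. -/
  carrier : Type w
  [top : TopologicalSpace carrier]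
  /-- The subspace `K'`. -/
  sub : Set carrier
  isFiniteCWPair : CWPairs.IsFiniteCWPair carrier sub

namespace FinCWPair

attribute [instance] FinCWPair.top

/-- Maps of pairs: continuous maps `K → L` that send `K'` into `L'`. -/
@[ext]
structure Hom (P Q : FinCWPair.{w}) where
  map : C(P.carrier, Q.carrier)
  mapsTo : MapsTo map P.sub Q.sub

instance : Category FinCWPair.{w} where
  Hom := Hom
  id P := ⟨ContinuousMap.id _, fun _ h => h⟩
  comp f g := ⟨g.map.comp f.map, g.mapsTo.comp f.mapsTo⟩

/-- Homotopy of maps of pairs: every stage of the homotopy is a map of pairs. -/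
def Homotopic {P Q : FinCWPair.{w}} (f g : P ⟶ Q) : Prop :=
  ContinuousMap.HomotopicWith f.map g.map (fun h => MapsTo h P.sub Q.sub)

/-- The pair `(B, A)` given by two subcomplexes `A ⊆ B` of a finite CW complex. -/
def ofSubcomplexes {X : Type w} [TopologicalSpace X] [T2Space X] [CWComplex (univ : Set X)]
    [CWComplex.Finite (univ : Set X)] (B A : CWComplex.Subcomplex (univ : Set X))
    (h : (A : Set X) ⊆ B) : FinCWPair.{w} where
  carrier := (B : Set X)
  sub := Subtype.val ⁻¹' (A : Set X)
  isFiniteCWPair := CWPairs.isFiniteCWPair_subcomplex A B h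

/-- The pair `(K, ∅)`. -/
def total (P : FinCWPair.{w}) : FinCWPair.{w} where
  carrier := P.carrier
  sub := ∅
  isFiniteCWPair := by
    obtain ⟨h, c, hc, -⟩ := P.isFiniteCWPair
    exact ⟨h, c, hc, CWPairs.emptySubcomplex univ, rfl⟩

/-- The pair `(K', ∅)`. -/
def subspace (P : FinCWPair.{w}) : FinCWPair.{w} where
  carrier := P.sub
  sub := ∅
  isFiniteCWPair := by
    obtain ⟨h, c, hc, E, hE⟩ := P.isFiniteCWPair
    rw [← hE]
    exact CWPairs.isFiniteCWPair_subcomplex (CWPairs.emptySubcomplex univ) E (empty_subset _)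

/-- The functor `(K, K') ↦ (K', ∅)`. -/
def subspaceFunctor : FinCWPair.{w} ⥤ FinCWPair.{w} where
  obj := subspace
  map {P Q} f :=
    { map := ⟨fun x => ⟨f.map x.1, f.mapsTo x.2⟩, by fun_prop⟩
      mapsTo := fun _ h => h.elim }

/-- The inclusion `i : (K', ∅) ⟶ (K, ∅)`. -/
def i (P : FinCWPair.{w}) : P.subspace ⟶ P.total where
  map := ⟨fun x => x.1, continuous_subtype_val⟩
  mapsTo := fun _ h => h.elim

/-- The inclusion `j : (K, ∅) ⟶ (K, K')`. -/
def j (P : FinCWPair.{w}) : P.total ⟶ P where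
  map := ContinuousMap.id _
  mapsTo := fun _ h => h.elim

/-- For subcomplexes `K`, `L` of a finite CW complex, the pair `(K, K ∩ L)`. -/
def exciseSource {X : Type w} [TopologicalSpace X] [T2Space X] [CWComplex (univ : Set X)]
    [CWComplex.Finite (univ : Set X)] (K L : CWComplex.Subcomplex (univ : Set X)) :
    FinCWPair.{w} :=
  ofSubcomplexes K (CWPairs.interSubcomplex K L) inter_subset_left

/-- For subcomplexes `K`, `L` of a finite CW complex, the pair `(K ∪ L, L)`. -/
def exciseTarget {X : Type w} [TopologicalSpace X] [T2Space X] [CWComplex (univ : Set X)]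
    [CWComplex.Finite (univ : Set X)] (K L : CWComplex.Subcomplex (univ : Set X)) :
    FinCWPair.{w} :=
  ofSubcomplexes (CWPairs.unionSubcomplex K L) L subset_union_right

/-- The inclusion `(K, K ∩ L) ⟶ (K ∪ L, L)`. -/
def excision {X : Type w} [TopologicalSpace X] [T2Space X] [CWComplex (univ : Set X)]
    [CWComplex.Finite (univ : Set X)] (K L : CWComplex.Subcomplex (univ : Set X)) :
    exciseSource K L ⟶ exciseTarget K L where
  map := ⟨inclusion (subset_union_left : (K : Set X) ⊆ K ∪ L), continuous_inclusion _⟩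
  mapsTo := fun _ h => h.2

end FinCWPair

/-- The data `{E_q, ∂_q}` of an `𝓐`-valued homology theory on pairs of finite CW-spaces. -/
structure HomologyData (𝓐 : Type u₁) [Category.{v₁} 𝓐] where
  /-- The functors `E_q`. -/
  E : ℤ → FinCWPair.{w} ⥤ 𝓐
  /-- The natural transformations `∂_q : E_{q+1}(K, K') → E_q(K')`. -/
  bdry (q : ℤ) : E (q + 1) ⟶ FinCWPair.subspaceFunctor ⋙ E q

namespace HomologyData

variable {𝓐 : Type u₁} [Category.{v₁} 𝓐] {𝓑 : Type u₂} [Category.{v₂} 𝓑]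

/-- Morphisms: natural transformations in each degree that commute with the boundary maps. -/
@[ext]
structure Hom (D D' : HomologyData.{w} 𝓐) where
  app (q : ℤ) : D.E q ⟶ D'.E q
  comm (q : ℤ) : D.bdry q ≫ Functor.whiskerLeft FinCWPair.subspaceFunctor (app q) =
    app (q + 1) ≫ D'.bdry q

instance : Category (HomologyData.{w} 𝓐) where
  Hom := Hom
  id D := ⟨fun q => 𝟙 _, fun q => by simp⟩
  comp f g := ⟨fun q => f.app q ≫ g.app q, fun q => by
    rw [Functor.whiskerLeft_comp, reassoc_of% (f.comm q), g.comm q, Category.assoc]⟩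

/-- Composition with a functor `G : 𝓐 ⥤ 𝓑`. -/
def comp (D : HomologyData.{w} 𝓐) (G : 𝓐 ⥤ 𝓑) : HomologyData.{w} 𝓑 where
  E q := D.E q ⋙ G
  bdry q := Functor.whiskerRight (D.bdry q) G

end HomologyData

/-- Exactness of `X ⟶ Y ⟶ Z` at `Y`: the composite vanishes and the homology at `Y` exists and
is zero. In an abelian category this is the usual notion. -/
def ExactAt {𝓐 : Type u₁} [Category.{v₁} 𝓐] [Limits.HasZeroMorphisms 𝓐] {X Y Z : 𝓐}
    (f : X ⟶ Y) (g : Y ⟶ Z) : Prop :=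
  ∃ w : f ≫ g = 0, (ShortComplex.mk f g w).Exact

/-- An `𝓐`-valued homology theory on pairs of finite CW-spaces. -/
structure HomologyTheory (𝓐 : Type u₁) [Category.{v₁} 𝓐] [Limits.HasZeroMorphisms 𝓐] extends
    HomologyData.{w} 𝓐 where
  homotopy (q : ℤ) {P Q : FinCWPair.{w}} (f g : P ⟶ Q) :
    FinCWPair.Homotopic f g → (E q).map f = (E q).map g
  excision (q : ℤ) {X : Type w} [TopologicalSpace X] [T2Space X] [CWComplex (univ : Set X)]
    [CWComplex.Finite (univ : Set X)] (K L : CWComplex.Subcomplex (univ : Set X)) :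
    IsIso ((E q).map (FinCWPair.excision K L))
  /-- Exactness at `E_q(K)`. -/
  exact_total (q : ℤ) (P : FinCWPair.{w}) : ExactAt ((E q).map P.i) ((E q).map P.j)
  /-- Exactness at `E_{q+1}(K, K')`. -/
  exact_pair (q : ℤ) (P : FinCWPair.{w}) :
    ExactAt ((E (q + 1)).map P.j) ((bdry q).app P)
  /-- Exactness at `E_q(K')`. -/
  exact_sub (q : ℤ) (P : FinCWPair.{w}) : ExactAt ((bdry q).app P) ((E q).map P.i)

end Theory

namespace GroupHopf

open TensorProduct Coalgebra

variable {k : Type u} [Field k] {G H K : Type u} [AddCommGroup G] [AddCommGroup H] [AddCommGroup K]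
  {A : Type u} [CommRing A] [HopfAlgebra k A]

/-- The Hopf algebra homomorphism `kG → A` that extends a homomorphism from `G` to the group-like
elements of `A`. -/
noncomputable def lift (f : Multiplicative G →* GroupLike k A) : AddMonoidAlgebra k G →ₐc[k] A :=
  BialgHom.ofAlgHom (AddMonoidAlgebra.lift k A G ((GroupLike.valMonoidHom k A).comp f))
    (by ext g; simp) (by ext g; simp)

theorem lift_single (f : Multiplicative G →* GroupLike k A) (g : G) :
    lift f (AddMonoidAlgebra.single g 1) = (f (Multiplicative.ofAdd g)).val := by
  change AddMonoidAlgebra.lift k A G ((GroupLike.valMonoidHom k A).comp f) _ = _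
  simp

theorem hom_ext {f g : AddMonoidAlgebra k G →ₐc[k] A}
    (h : ∀ x : G, f (AddMonoidAlgebra.single x 1) = g (AddMonoidAlgebra.single x 1)) : f = g := by
  refine AddMonoidAlgebra.bialgHom_ext h ?_
  ext

/-- A Hopf algebra homomorphism `A → kH` whose composite with `kπ : kH → kK` is trivial takes
values in `k[ker π]`. -/
theorem coeff_eq_zero (φ : A →ₐc[k] AddMonoidAlgebra k H) (π : H →+ K)
    (hφ : ∀ x, AddMonoidAlgebra.mapDomainBialgHom k π (φ x) = algebraMap k _ (counit x))
    (x : A) (h : H) (hh : π h ≠ 0) : (φ x).coeff h = 0 := by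
  -- compare the two ways to compute `(id ⊗ kπ)(Δ(φ x))` in the coordinate `(h, π h)`
  let F : AddMonoidAlgebra k H ⊗[k] AddMonoidAlgebra k K →ₗ[k] k :=
    LinearMap.mul' k k ∘ₗ TensorProduct.map
      (Finsupp.lapply h ∘ₗ (AddMonoidAlgebra.coeffLinearEquiv k).toLinearMap)
      (Finsupp.lapply (π h) ∘ₗ (AddMonoidAlgebra.coeffLinearEquiv k).toLinearMap)
  have h1 : ∀ y : AddMonoidAlgebra k H,
      F (TensorProduct.map LinearMap.id
        (AddMonoidAlgebra.mapDomainBialgHom k π : AddMonoidAlgebra k H →ₗ[k] _) (comul y)) =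
        y.coeff h := by
    intro y
    induction y using AddMonoidAlgebra.induction_linear with
    | zero => simp
    | add y z hy hz => simp [hy, hz]
    | single g a =>
      by_cases hg : g = h
      · subst hg; simp [F]
      · simp [F, hg]
  rw [← h1 (φ x), ← CoalgHomClass.map_comp_comul_apply, ← (ℛ k x).eq]
  simp only [map_sum, TensorProduct.map_tmul]
  refine Finset.sum_eq_zero fun i _ => ?_
  have h2 : (AddMonoidAlgebra.mapDomainBialgHom k π (φ ((ℛ k x).right i))).coeff (π h) = 0 := by
    rw [hφ]
    simp [hh]
  change _ * (AddMonoidAlgebra.mapDomainBialgHom k π (φ ((ℛ k x).right i))).coeff (π h) = 0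
  rw [h2, mul_zero]

/-- The group algebra of a subgroup embeds. -/
theorem mapDomain_injective (ι : G →+ H) (hι : Function.Injective ι) :
    Function.Injective (AddMonoidAlgebra.mapDomainBialgHom k ι) := by
  exact AddMonoidAlgebra.mapDomain_injective hι

/-- A Hopf algebra homomorphism `A → kH` whose composite with `kπ` is trivial factors through `kG`
whenever `G` is the kernel of `π`. -/
theorem exists_factor (φ : A →ₐc[k] AddMonoidAlgebra k H) (ι : G →+ H) (π : H →+ K)
    (hι : Function.Injective ι) (hex : ∀ h, π h = 0 → h ∈ Set.range ι)
    (hφ : ∀ x, AddMonoidAlgebra.mapDomainBialgHom k π (φ x) = algebraMap k _ (counit x)) :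
    ∃ ψ : A →ₐc[k] AddMonoidAlgebra k G,
      ∀ x, AddMonoidAlgebra.mapDomainBialgHom k ι (ψ x) = φ x := by
  set j := AddMonoidAlgebra.mapDomainBialgHom k ι with hj
  have hinj : Function.Injective j := mapDomain_injective ι hι
  have hrange : ∀ x, φ x ∈ (j : AddMonoidAlgebra k G →ₐ[k] AddMonoidAlgebra k H).range := by
    intro x
    rw [← AddMonoidAlgebra.sum_coeff_single (φ x)]
    refine Subalgebra.sum_mem _ fun h hh => ?_
    have hπ : π h = 0 := by
      by_contra hne
      exact (Finsupp.mem_support_iff.1 hh) (coeff_eq_zero φ π hφ x h hne)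
    obtain ⟨g, rfl⟩ := hex h hπ
    exact ⟨AddMonoidAlgebra.single g ((φ x).coeff (ι g)), by simp [hj]⟩
  let e := AlgEquiv.ofInjective (j : AddMonoidAlgebra k G →ₐ[k] AddMonoidAlgebra k H) hinj
  let ψ : A →ₐ[k] AddMonoidAlgebra k G :=
    (e.symm : _ →ₐ[k] _).comp ((φ : A →ₐ[k] AddMonoidAlgebra k H).codRestrict _ hrange)
  have hψ : ∀ x, j (ψ x) = φ x := fun x => by
    have := e.apply_symm_apply ⟨φ x, hrange x⟩
    exact congrArg Subtype.val this
  refine ⟨BialgHom.ofAlgHom ψ ?_ ?_, hψ⟩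
  · ext x
    change counit (ψ x) = counit x
    rw [← CoalgHomClass.counit_comp_apply j, hψ, CoalgHomClass.counit_comp_apply]
  · ext x
    have hinj2 : Function.Injective
        (TensorProduct.map (j : AddMonoidAlgebra k G →ₗ[k] AddMonoidAlgebra k H)
          (j : AddMonoidAlgebra k G →ₗ[k] AddMonoidAlgebra k H)) :=
      TensorProduct.map_injective_of_flat_flat _ _ hinj hinj
    apply hinj2
    change TensorProduct.map _ _ (TensorProduct.map ψ.toLinearMap ψ.toLinearMap (comul x)) =
      TensorProduct.map _ _ (comul (ψ x))
    have h1 := CoalgHomClass.map_comp_comul_apply j (ψ x)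
    have h2 := CoalgHomClass.map_comp_comul_apply φ x
    rw [hψ, ← h2] at h1
    refine Eq.trans ?_ h1.symm
    rw [← LinearMap.comp_apply, ← TensorProduct.map_comp]
    have h3 : (j : AddMonoidAlgebra k G →ₗ[k] AddMonoidAlgebra k H) ∘ₗ ψ.toLinearMap =
      (φ : A →ₗ[k] AddMonoidAlgebra k H) := LinearMap.ext hψ
    exact congrArg (fun l => TensorProduct.map l l (comul x)) h3

end GroupHopf

/-- The category `Hopf^bicom_k` of commutative and cocommutative Hopf algebras over `k`. -/
abbrev BicommHopf (k : Type u) [Field k] : Type (u + 1) :=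
  ObjectProperty.FullSubcategory
    (fun A : CommHopfAlgCat.{u} k => Coalgebra.IsCocomm k A)

namespace BicommHopf

variable {k : Type u} [Field k]

/-- The underlying type of a bicommutative Hopf algebra. -/
abbrev carrier (A : BicommHopf k) : Type u := A.obj

/-- The Hopf algebra homomorphism underlying a morphism. -/
abbrev toBialgHom {A B : BicommHopf k} (f : A ⟶ B) : A.carrier →ₐc[k] B.carrier := f.hom.hom

/-- A Hopf algebra homomorphism as a morphism. -/
abbrev ofBialgHom {A B : BicommHopf k} (f : A.carrier →ₐc[k] B.carrier) : A ⟶ B :=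
  ObjectProperty.homMk (CommHopfAlgCat.ofHom f)

theorem ext {A B : BicommHopf k} {f g : A ⟶ B} (h : ∀ x : A.carrier, toBialgHom f x = toBialgHom g x) :
    f = g := by
  apply ObjectProperty.hom_ext
  apply CommHopfAlgCat.hom_ext
  exact BialgHom.ext h

/-- The zero morphism `A → B` is the composite of the counit `A → k` and the unit `k → B`. -/
noncomputable instance : Limits.HasZeroMorphisms (BicommHopf k) where
  zero A B := ⟨ofBialgHom ((Bialgebra.unitBialgHom k B.carrier).comp
    (Bialgebra.counitBialgHom k A.carrier))⟩
  comp_zero {A B} f C := by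
    refine BicommHopf.ext fun x => ?_
    change algebraMap k C.carrier (Coalgebra.counit (toBialgHom f x)) =
      algebraMap k C.carrier (Coalgebra.counit x)
    rw [CoalgHomClass.counit_comp_apply]
  zero_comp A {B C} f := by
    refine BicommHopf.ext fun x => ?_
    change toBialgHom f (algebraMap k B.carrier (Coalgebra.counit x)) =
      algebraMap k C.carrier (Coalgebra.counit x)
    exact AlgHomClass.commutes (toBialgHom f) _

theorem zero_apply {A B : BicommHopf k} (x : A.carrier) :
    toBialgHom (0 : A ⟶ B) x = algebraMap k B.carrier (Coalgebra.counit x) := rfl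

/-- Group-like elements are mapped to group-like elements. -/
def mapGroupLike {A B : BicommHopf k} (f : A ⟶ B) :
    GroupLike k A.carrier →* GroupLike k B.carrier where
  toFun g := ⟨toBialgHom f g.val, g.2.map _⟩
  map_one' := GroupLike.ext (map_one (toBialgHom f))
  map_mul' a b := GroupLike.ext (map_mul (toBialgHom f) a.val b.val)

/-- The functor `GE` that sends a bicommutative Hopf algebra to its abelian group of group-like
elements (written additively). -/
def groupLikeFunctor (k : Type u) [Field k] : BicommHopf k ⥤ Ab.{u} where
  obj A := AddCommGrpCat.of (Additive (GroupLike k A.carrier))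
  map f := AddCommGrpCat.ofHom (MonoidHom.toAdditive (mapGroupLike f))

/-- The group Hopf algebra functor `G ↦ kG` on abelian groups. -/
noncomputable def groupHopfFunctor (k : Type u) [Field k] : Ab.{u} ⥤ BicommHopf k where
  obj G := ⟨CommHopfAlgCat.of k (AddMonoidAlgebra k G),
    inferInstanceAs (Coalgebra.IsCocomm k (AddMonoidAlgebra k G))⟩
  map f := ofBialgHom (AddMonoidAlgebra.mapDomainBialgHom k f.hom)
  map_id G := by
    refine BicommHopf.ext fun x => ?_
    exact DFunLike.congr_fun (AddMonoidAlgebra.mapDomainBialgHom_id (R := k) (M := G)) x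
  map_comp f g := by
    refine BicommHopf.ext fun x => ?_
    exact DFunLike.congr_fun (AddMonoidAlgebra.mapDomainBialgHom_comp (R := k) g.hom f.hom) x

/-- The group Hopf algebra functor is left adjoint to the functor of group-like elements. -/
noncomputable def adjunction (k : Type u) [Field k] : groupHopfFunctor k ⊣ groupLikeFunctor k :=
  Adjunction.mkOfHomEquiv
    { homEquiv := fun G A =>
        { toFun := fun f => AddCommGrpCat.ofHom
            { toFun := fun g => Additive.ofMul
                ⟨toBialgHom f (AddMonoidAlgebra.single g 1),
                  (AddMonoidAlgebra.isGroupLikeElem_single_one g).map _⟩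
              map_zero' := congrArg Additive.ofMul (GroupLike.ext (map_one (toBialgHom f)))
              map_add' := fun a b => congrArg Additive.ofMul (GroupLike.ext (by
                have h : (AddMonoidAlgebra.single (a + b) 1 : AddMonoidAlgebra k G) =
                    AddMonoidAlgebra.single a 1 * AddMonoidAlgebra.single b 1 := by simp
                change toBialgHom f (AddMonoidAlgebra.single (a + b) 1 : AddMonoidAlgebra k G) = _
                rw [h]
                exact map_mul (toBialgHom f) _ _)) }
          invFun := fun f => ofBialgHom (A := (groupHopfFunctor k).obj G)
            (GroupHopf.lift (AddMonoidHom.toMultiplicativeLeft f.hom))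
          left_inv := fun f => BicommHopf.ext fun x => DFunLike.congr_fun
            (GroupHopf.hom_ext (g := toBialgHom f) fun g => GroupHopf.lift_single _ g) x
          right_inv := fun f => AddCommGrpCat.ext fun g =>
            congrArg Additive.ofMul (GroupLike.ext (GroupHopf.lift_single _ g)) }
      homEquiv_naturality_left_symm := fun {G' G A} f g => BicommHopf.ext fun x =>
        DFunLike.congr_fun (GroupHopf.hom_ext (k := k) (G := G') (A := A.carrier)
          (f := GroupHopf.lift (AddMonoidHom.toMultiplicativeLeft (f ≫ g).hom))
          (g := (GroupHopf.lift (AddMonoidHom.toMultiplicativeLeft g.hom)).comp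
            (AddMonoidAlgebra.mapDomainBialgHom k f.hom)) fun y => by
              rw [GroupHopf.lift_single, BialgHom.comp_apply,
                AddMonoidAlgebra.mapDomainBialgHom_single, GroupHopf.lift_single]
              rfl) x
      homEquiv_naturality_right := fun f g => rfl }

instance : (groupHopfFunctor k).PreservesZeroMorphisms where
  map_zero G H := BicommHopf.ext fun x => DFunLike.congr_fun
    (GroupHopf.hom_ext (k := k) (G := G) (A := AddMonoidAlgebra k H)
      (f := AddMonoidAlgebra.mapDomainBialgHom k (0 : G →+ H))
      (g := (Bialgebra.unitBialgHom k _).comp (Bialgebra.counitBialgHom k _)) fun y => by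
        rw [AddMonoidAlgebra.mapDomainBialgHom_single]
        change _ = algebraMap k (AddMonoidAlgebra k H) (Coalgebra.counit _)
        simp) x

/-- The group Hopf algebra functor is exact. -/
instance : (groupHopfFunctor k).PreservesHomology where
  preservesKernels G H f := by
    refine Limits.preservesLimit_of_preserves_limit_cone (AddCommGrpCat.kernelIsLimit f) ?_
    refine (Limits.KernelFork.isLimitMapConeEquiv _ _).symm ?_
    refine Limits.Fork.IsLimit.mk' _ fun s => ?_
    have hs : s.ι ≫ (groupHopfFunctor k).map f = 0 := by
      rw [Limits.Fork.condition, Limits.comp_zero]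
    have hψ := GroupHopf.exists_factor (toBialgHom s.ι) f.hom.ker.subtype f.hom
      Subtype.val_injective (fun h hh => ⟨⟨h, hh⟩, rfl⟩)
      (fun x => DFunLike.congr_fun (congrArg toBialgHom hs) x)
    refine ⟨ofBialgHom hψ.choose, BicommHopf.ext hψ.choose_spec, fun {m} hm =>
      BicommHopf.ext fun x => ?_⟩
    refine GroupHopf.mapDomain_injective (k := k) f.hom.ker.subtype Subtype.val_injective ?_
    exact (DFunLike.congr_fun (congrArg toBialgHom hm) x).trans (hψ.choose_spec x).symm
  preservesCokernels G H f := by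
    have := (adjunction k).leftAdjoint_preservesColimits
    infer_instance

/-- A (finite-dimensional) Hopf algebra is cosemisimple if its dual Hopf algebra is semisimple: the
ring `Hom_k(A, k)` with the convolution product is a semisimple ring. -/
def IsCosemisimple (A : BicommHopf k) : Prop :=
  IsSemisimpleRing (WithConv (A.carrier →ₗ[k] k))

end BicommHopf

theorem ExactAt.map {𝓐 : Type u₁} [Category.{v₁} 𝓐] [Limits.HasZeroMorphisms 𝓐] {𝓑 : Type u₂}
    [Category.{v₂} 𝓑] [Limits.HasZeroMorphisms 𝓑] (G : 𝓐 ⥤ 𝓑) [G.PreservesZeroMorphisms]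
    [G.PreservesHomology] {X Y Z : 𝓐} {f : X ⟶ Y} {g : Y ⟶ Z} (h : ExactAt f g) :
    ExactAt (G.map f) (G.map g) := by
  obtain ⟨w, hw⟩ := h
  exact ⟨by rw [← G.map_comp, w, G.map_zero], hw.map G⟩

/-- The `Hopf^bicom_k`-valued homology theory `kF` induced by an `Ab`-valued homology theory `F`. -/
noncomputable def HomologyTheory.groupHopf (k : Type u) [Field k] (F : HomologyTheory.{w} Ab.{u}) :
    HomologyTheory.{w} (BicommHopf k) where
  toHomologyData := F.toHomologyData.comp (BicommHopf.groupHopfFunctor k)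
  homotopy q _ _ f g h := congrArg (BicommHopf.groupHopfFunctor k).map (F.homotopy q f g h)
  excision q _ _ _ _ _ K L := by
    have := F.excision q K L
    exact inferInstanceAs (IsIso ((BicommHopf.groupHopfFunctor k).map _))
  exact_total q P := (F.exact_total q P).map (BicommHopf.groupHopfFunctor k)
  exact_pair q P := (F.exact_pair q P).map (BicommHopf.groupHopfFunctor k)
  exact_sub q P := (F.exact_sub q P).map (BicommHopf.groupHopfFunctor k)

/-! The functor `G ↦ kG` is left adjoint to the group-like elements functor, so everything reduces
to showing that the counit `k[GE(A)] → A` is an isomorphism for each value `A` of the theory. Being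
the counit of an adjunction, it is natural in `A`, and this settles compatibility with induced maps
and with `∂_q` at once.

For a single `A`, the argument passes to the dual. Cocommutativity makes the convolution algebra
`A*` commutative; being semisimple, it is reduced, so over algebraically closed `k` its points are
separated by characters `A* → k`. By finite-dimensional biduality a character is evaluation at a
group-like element (`exists_groupLike_of_algHom`). Hence no nonzero functional kills all
group-likes, and they span `A` (`span_groupLike_eq_top`). Group-likes are always linearly
independent, so they form a basis and the counit is bijective (`lift_bijective`,
`isIso_counit_app`).

Homotopy invariance and excision survive any functor. Exactness of the group-like sequences is the
remaining point: `G ↦ kG` is exact and faithful, so it reflects exactness, and via the counits its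
image of the group-like sequence is the given exact sequence (`exactAt_groupLike`). -/

namespace GroupHopf

open TensorProduct Coalgebra

/-! ### Characters of the dual algebra and group-like elements -/

/-- Pairs of functionals separate the points of a tensor square. -/
theorem tensor_ext {k A : Type*} [Field k] [AddCommGroup A] [Module k A] [FiniteDimensional k A]
    {x y : A ⊗[k] A}
    (h : ∀ f g : A →ₗ[k] k, LinearMap.mul' k k (TensorProduct.map f g x) =
      LinearMap.mul' k k (TensorProduct.map f g y)) : x = y := by
  let b := Module.finBasis k A
  refine (b.tensorProduct b).ext_elem fun ij => ?_
  -- The coordinates in the product basis are themselves pairs of functionals, namely of coordinate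
  -- functionals.
  have key : ∀ z : A ⊗[k] A, (b.tensorProduct b).repr z ij =
      LinearMap.mul' k k (TensorProduct.map (b.coord ij.1) (b.coord ij.2) z) := fun z => by
    induction z with
    | zero => simp
    | add y z hy hz => simp [hy, hz]
    | tmul c d =>
      obtain ⟨i, j⟩ := ij
      rw [Module.Basis.tensorProduct_repr_tmul_apply]
      simp [mul_comm]
  rw [key, key, h]

section Coalgebra

variable {k A : Type*} [Field k] [AddCommGroup A] [Module k A] [Coalgebra k A]
  [FiniteDimensional k A]

/-- An algebra homomorphism from the dual of a finite-dimensional coalgebra to the ground field is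
the evaluation at a group-like element. -/
theorem exists_groupLike_of_algHom (χ : WithConv (A →ₗ[k] k) →ₐ[k] k) :
    ∃ a : GroupLike k A, ∀ f : WithConv (A →ₗ[k] k), χ f = f a.val := by
  -- Forgetting multiplicativity, `χ` lies in the double dual of `A`, so it is evaluation at some
  -- `a`.
  let χ' : Module.Dual k (Module.Dual k A) :=
    { toFun := fun f => χ (WithConv.toConv f)
      map_add' := fun f g => map_add χ _ _
      map_smul' := fun c f => map_smul χ c _ }
  obtain ⟨a, ha⟩ := (Module.evalEquiv k A).surjective χ'
  have hχ : ∀ f : WithConv (A →ₗ[k] k), χ f = f a := fun f =>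
    (DFunLike.congr_fun ha f.ofConv).symm
  refine ⟨⟨a, ?_, tensor_ext fun f g => ?_⟩, hχ⟩
  -- The unit of the convolution algebra is the counit of `A`, so `χ 1 = 1` says `ε(a) = 1`.
  · have := hχ 1
    rw [map_one] at this
    simpa using this.symm
  -- Multiplicativity of `χ` reads `(f ⊗ g)(Δ a) = f(a) g(a)`; as `f` and `g` vary this forces `Δ a
  -- = a ⊗ a`.
  · have := hχ (WithConv.toConv f * WithConv.toConv g)
    rw [map_mul, hχ, hχ] at this
    simpa using this.symm

/-- The algebra homomorphisms to `k` separate the points of a reduced finite-dimensional algebra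
over an algebraically closed field. -/
theorem exists_algHom_apply_ne_zero {B : Type*} [CommRing B] [Algebra k B] [IsAlgClosed k]
    [FiniteDimensional k B] [IsReduced B] {b : B} (hb : b ≠ 0) : ∃ χ : B →ₐ[k] k, χ b ≠ 0 := by
  have : IsArtinianRing B := IsArtinianRing.of_finite k B
  -- In a reduced ring the primes intersect in zero. Since `B` is Artinian, `p` is maximal, and the
  -- residue field, finite over algebraically closed `k`, is `k` itself.
  obtain ⟨p, hp, hbp⟩ : ∃ p : Ideal B, p.IsPrime ∧ b ∉ p := by
    by_contra! h
    exact hb (nilpotent_iff_mem_prime.2 fun p hp => h p hp).eq_zero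
  have : p.IsMaximal := inferInstance
  let := Ideal.Quotient.field p
  have hbij := IsAlgClosed.algebraMap_bijective_of_isIntegral (k := k) (K := B ⧸ p)
  let e := AlgEquiv.ofBijective (Algebra.ofId k (B ⧸ p)) hbij
  refine ⟨(e.symm : _ →ₐ[k] k).comp (Ideal.Quotient.mkₐ k p), ?_⟩
  simpa [Ideal.Quotient.eq_zero_iff_mem] using hbp

/-- A finite-dimensional cocommutative coalgebra with semisimple dual over an algebraically closed
field is spanned by its group-like elements. -/
theorem span_groupLike_eq_top [IsAlgClosed k] [IsCocomm k A]
    [IsSemisimpleRing (WithConv (A →ₗ[k] k))] :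
    Submodule.span k (Set.range (GroupLike.val (R := k) (A := A))) = ⊤ := by
  have : FiniteDimensional k (WithConv (A →ₗ[k] k)) :=
    Module.Finite.equiv (WithConv.linearEquiv k (A →ₗ[k] k)).symm
  by_contra hne
  -- A nonzero functional killing every group-like element would be killed by every character of the
  -- dual algebra.
  obtain ⟨f, hf, hle⟩ := Submodule.exists_le_ker_of_lt_top _ (lt_top_iff_ne_top.2 hne)
  obtain ⟨χ, hχ⟩ := exists_algHom_apply_ne_zero (k := k) (B := WithConv (A →ₗ[k] k))
    (b := WithConv.toConv f) fun h => hf (congrArg WithConv.ofConv h)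
  obtain ⟨a, ha⟩ := exists_groupLike_of_algHom χ
  exact hχ ((ha _).trans (hle (Submodule.subset_span ⟨a, rfl⟩)))

end Coalgebra

/-! ### Recognizing group algebras -/

variable {k : Type u} [Field k] {G : Type u} [AddCommGroup G] {A : Type u} [CommRing A]
  [HopfAlgebra k A]

/-- This form lets injectivity of `lift f` be read off as linear independence of a family of
group-like elements. -/
theorem lift_apply (f : Multiplicative G →* GroupLike k A) (x : AddMonoidAlgebra k G) :
    lift f x = Finsupp.linearCombination k
      (fun g => (f (Multiplicative.ofAdd g)).val) x.coeff := by
  induction x using AddMonoidAlgebra.induction_linear with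
  | zero => simp
  | add y z hy hz => simp [hy, hz]
  | single g a =>
    have h : (AddMonoidAlgebra.single g a : AddMonoidAlgebra k G) =
      a • AddMonoidAlgebra.single g 1 := by simp
    rw [h, map_smul, lift_single]
    simp

/-- If the group-like elements span `A` then `A` is a group algebra. -/
theorem lift_bijective (f : Multiplicative G →* GroupLike k A) (hf : Function.Bijective f)
    (h : Submodule.span k (Set.range (GroupLike.val (R := k) (A := A))) = ⊤) :
    Function.Bijective (lift f) := by
  -- Distinct group-like elements are linearly independent, with no hypothesis on `A`; only
  -- surjectivity uses the spanning assumption.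
  have hli : LinearIndependent k
      (fun g : G => (f (Multiplicative.ofAdd g)).val) :=
    (linearIndep_groupLikeVal (R := k) (A := A)).comp (fun g => f (Multiplicative.ofAdd g))
      (hf.injective.comp Multiplicative.ofAdd.injective)
  constructor
  · intro x y hxy
    rw [lift_apply, lift_apply] at hxy
    exact AddMonoidAlgebra.coeff_injective (hli hxy)
  · have hsurj : Submodule.span k (Set.range (GroupLike.val (R := k) (A := A))) ≤
        LinearMap.range (lift f : AddMonoidAlgebra k G →ₗ[k] A) := by
      rw [Submodule.span_le]
      rintro _ ⟨a, rfl⟩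
      obtain ⟨g, rfl⟩ := hf.surjective a
      exact ⟨AddMonoidAlgebra.single g.toAdd 1, lift_single f _⟩
    exact fun y => hsurj (h ▸ Submodule.mem_top)

end GroupHopf

/-! ### The counit of the adjunction and reflection of exactness -/

namespace BicommHopf

variable {k : Type u} [Field k]

theorem isIso_of_bijective {A B : BicommHopf k} (f : A ⟶ B)
    (hf : Function.Bijective (toBialgHom f)) : IsIso f := by
  let e := BialgEquiv.ofBijective (toBialgHom f) hf
  refine ⟨ofBialgHom (e.symm : B.carrier →ₐc[k] A.carrier), BicommHopf.ext fun x => ?_,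
    BicommHopf.ext fun x => ?_⟩
  · exact e.symm_apply_apply x
  · exact e.apply_symm_apply x

/-- Over an algebraically closed field, a finite-dimensional cosemisimple bicommutative Hopf algebra
is the group algebra of its group-like elements. -/
theorem isIso_counit_app [IsAlgClosed k] (A : BicommHopf k) [FiniteDimensional k A.carrier]
    (hA : A.IsCosemisimple) : IsIso ((adjunction k).counit.app A) := by
  have : Coalgebra.IsCocomm k A.carrier := A.property
  have : IsSemisimpleRing (WithConv (A.carrier →ₗ[k] k)) := hA
  refine isIso_of_bijective _ ?_
  rw [adjunction, Adjunction.mkOfHomEquiv_counit_app]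
  -- The counit at `A` is the lift of the identity on the group of group-like elements.
  exact GroupHopf.lift_bijective _ Function.bijective_id
    (GroupHopf.span_groupLike_eq_top (k := k) (A := A.carrier))

/-- A group homomorphism is recovered from the induced algebra map on the basis elements `single x
1`, which are distinct because `1 ≠ 0` in `k`. -/
instance : (groupHopfFunctor k).Faithful where
  map_injective {G H f g} h := AddCommGrpCat.ext fun x => by
    have := DFunLike.congr_fun (congrArg toBialgHom h)
      (AddMonoidAlgebra.single x 1 : AddMonoidAlgebra k G)
    change AddMonoidAlgebra.mapDomainBialgHom k f.hom _ =
      AddMonoidAlgebra.mapDomainBialgHom k g.hom _ at this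
    rw [AddMonoidAlgebra.mapDomainBialgHom_single, AddMonoidAlgebra.mapDomainBialgHom_single] at this
    exact AddMonoidAlgebra.of_injective this

/-- The functor of group-like elements preserves the exactness of sequences of group algebras. -/
theorem exactAt_groupLike {A B C : BicommHopf k} {f : A ⟶ B} {g : B ⟶ C} (h : ExactAt f g)
    [IsIso ((adjunction k).counit.app A)] [IsIso ((adjunction k).counit.app B)]
    [IsIso ((adjunction k).counit.app C)] :
    ExactAt ((groupLikeFunctor k).map f) ((groupLikeFunctor k).map g) := by
  obtain ⟨w, hw⟩ := h
  have hz : (groupLikeFunctor k).map f ≫ (groupLikeFunctor k).map g = 0 := by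
    rw [← Functor.map_comp, w]
    -- The zero morphism sends a group-like `x` to `ε(x) · 1 = 1`, the neutral element of the group
    -- of group-likes.
    refine AddCommGrpCat.ext fun x => congrArg Additive.ofMul (GroupLike.ext ?_)
    change toBialgHom (0 : A ⟶ C) (Additive.toMul x).val = 1
    rw [zero_apply, (Additive.toMul x).2.counit_eq_one, map_one]
  refine ⟨hz, ?_⟩
  -- Exactness is tested after applying the faithful exact functor `G ↦ kG`; the three counits then
  -- identify the result with the original complex.
  rw [← ShortComplex.exact_map_iff_of_faithful _ (groupHopfFunctor k)]
  refine (ShortComplex.exact_iff_of_iso ?_).2 hw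
  let eA := asIso ((adjunction k).counit.app A)
  let eB := asIso ((adjunction k).counit.app B)
  let eC := asIso ((adjunction k).counit.app C)
  exact ShortComplex.isoMk eA eB eC
    ((adjunction k).counit.naturality f).symm ((adjunction k).counit.naturality g).symm

end BicommHopf

/-! ### Transfer to homology theories -/

namespace HomologyData

variable {𝓐 : Type u₁} [Category.{v₁} 𝓐]

/-- A morphism of homology data that consists of isomorphisms is an isomorphism. -/
noncomputable def isoOfApp {D D' : HomologyData.{w} 𝓐} (f : D ⟶ D') [∀ q, IsIso (f.app q)] :
    D ≅ D' where
  hom := f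
  inv :=
    { app := fun q => inv (f.app q)
      comm := fun q => by
        rw [IsIso.eq_inv_comp, ← Category.assoc, ← f.comm q, Category.assoc,
          ← Functor.whiskerLeft_comp, IsIso.hom_inv_id]
        exact Category.comp_id _ }
  hom_inv_id := HomologyData.Hom.ext (funext fun q => IsIso.hom_inv_id (f.app q))
  inv_hom_id := HomologyData.Hom.ext (funext fun q => IsIso.inv_hom_id (f.app q))

end HomologyData

/-- The homology theory of group-like elements of a `Hopf^bicom_k`-valued homology theory that takes
values in group algebras. -/
def HomologyTheory.groupLike {k : Type u} [Field k] (E : HomologyTheory.{w} (BicommHopf k))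
    (h : ∀ q P, IsIso ((BicommHopf.adjunction k).counit.app ((E.E q).obj P))) :
    HomologyTheory.{w} Ab.{u} where
  toHomologyData := E.toHomologyData.comp (BicommHopf.groupLikeFunctor k)
  homotopy q _ _ f g hfg := congrArg (BicommHopf.groupLikeFunctor k).map (E.homotopy q f g hfg)
  excision q _ _ _ _ _ K L := by
    have := E.excision q K L
    exact inferInstanceAs (IsIso ((BicommHopf.groupLikeFunctor k).map _))
  exact_total q P :=
    have := h q P.subspace
    have := h q P.total
    have := h q P
    BicommHopf.exactAt_groupLike (E.exact_total q P)
  exact_pair q P :=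
    have := h (q + 1) P.total
    have := h (q + 1) P
    -- The target of `∂_q` is typed as a value of the composite functor at `P`; it unfolds to
    -- `E_q(K')`.
    have : IsIso ((BicommHopf.adjunction k).counit.app
      ((FinCWPair.subspaceFunctor ⋙ E.E q).obj P)) := h q P.subspace
    BicommHopf.exactAt_groupLike (E.exact_pair q P)
  exact_sub q P :=
    have := h (q + 1) P
    have : IsIso ((BicommHopf.adjunction k).counit.app
      ((FinCWPair.subspaceFunctor ⋙ E.E q).obj P)) := h q P.subspace
    have := h q P.total
    BicommHopf.exactAt_groupLike (E.exact_sub q P)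

/-- The morphism from the group algebras of the group-like elements given by the counit of the
adjunction. -/
noncomputable def HomologyData.groupHopfCounit {k : Type u} [Field k]
    (D : HomologyData.{w} (BicommHopf k)) :
    (D.comp (BicommHopf.groupLikeFunctor k)).comp (BicommHopf.groupHopfFunctor k) ⟶ D :=
  HomologyData.Hom.mk
    (fun q => Functor.whiskerLeft (D.E q) (BicommHopf.adjunction k).counit)
    (fun q => by
      ext P : 2
      -- Compatibility with `∂_q` is naturality of the counit at the morphism `∂_q` itself.
      exact (BicommHopf.adjunction k).counit.naturality ((D.bdry q).app P))

theorem proposition202005031005 (k : Type u) [Field k] [IsAlgClosed k]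
    (E : HomologyTheory.{w} (BicommHopf k))
    (hfin : ∀ (q : ℤ) (P : FinCWPair.{w}), FiniteDimensional k ((E.E q).obj P).carrier)
    (hcos : ∀ (q : ℤ) (P : FinCWPair.{w}), ((E.E q).obj P).IsCosemisimple) :
    ∃ F : HomologyTheory.{w} Ab.{u},
      F.toHomologyData = E.toHomologyData.comp (BicommHopf.groupLikeFunctor k) ∧
      Nonempty (E.toHomologyData ≅ (F.groupHopf k).toHomologyData) := by
  have h : ∀ q P, IsIso ((BicommHopf.adjunction k).counit.app ((E.E q).obj P)) := fun q P =>
    have := hfin q P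
    BicommHopf.isIso_counit_app _ (hcos q P)
  have (q : ℤ) : IsIso ((HomologyData.groupHopfCounit E.toHomologyData).app q) :=
    have (P : FinCWPair.{w}) :
        IsIso (((HomologyData.groupHopfCounit E.toHomologyData).app q).app P) := h q P
    NatIso.isIso_of_isIso_app _
  -- The counit runs from `kF` to `E`, hence the `symm`.
  exact ⟨E.groupLike h, rfl,
    ⟨(HomologyData.isoOfApp (HomologyData.groupHopfCounit E.toHomologyData)).symm⟩⟩
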